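/- Let $n,m,q$ be natural numbers and let all spaces (and products of them) carry the maximum norm. Let $c\colon\mathbb R^n\to\mathbb R^m$, $A\colon\mathbb R^n\to\mathbb R^q$ and $B\colon\mathbb R^n\to\mathbb R^{q\times m}$ be locally Lipschitz continuous. For $x\in\mathbb R^n$ put $f(x,y)=c(x)^\top y$, $g(x,y)=A(x)+B(x)y$, $\Gamma(x)=\{y\in\mathbb R^m : g(x,y)\le 0\}$, $\varphi(x)=\inf\{f(x,y): y\in\Gamma(x)\}\in[-\infty,+\infty]$, $S(x)=\operatorname{argmin}\{f(x,y): y\in\Gamma(x)\}$, and $\Phi(x)=\{y\in\mathbb R^m: f(x,y)-\varphi(x)\le 0,\ g(x,y)\le 0\}$. For a set-valued map $\Upsilon$ let $\operatorname{dom}\Upsilon=\{x:\Upsilon(x)\ne\varnothing\}$. Fix $(\bar x,\bar y)$ with $\bar y\in S(\bar x)$ such that $S$ is inner semicontinuous at $(\bar x,\bar y)$, i.e. for each sequence $x_k\to\bar x$ there is a sequence $y_k\to\bar y$ with $y_k\in S(x_k)$ for all sufficiently large $k$. Let $I=\{i\in\{1,\dots,q\} : g_i(\bar x,\bar y)=0\}$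 and let $$\mathcal B(x)=\begin{bmatrix}c(x)^\top\\ B(x)_I\end{bmatrix},$$ where $B(x)_I$ consists of the rows of $B(x)$ with index in $I$. Assume that there is a neighbourhood $U\subset\mathbb R^n$ of $\bar x$ such that, for each $J\subset\{1,\dots,|I|+1\}$, the matrix $\mathcal B(x)_J$ formed by the rows of $\mathcal B(x)$ with index in $J$ has constant rank for all $x\in U$. Then the following hold. 1. (R-regularity constraint qualification, RRCQ.) The function $\varphi$ is finite and continuous on a neighbourhood of $\bar x$, and there are $\kappa>0$ and $\varepsilon>0$ such that for all $(x,y)$ with $\|(x,y)-(\bar x,\bar y)\|_\infty<\varepsilon$ and $x\in\operatorname{dom}\Phi$, $$\operatorname{dist}(y,\Phi(x))\le\kappa\max\{0,\ f(x,y)-\varphi(x),\ g_1(x,y),\dots,g_q(x,y)\}.$$ 2. (Local uniformly weak sharp minimum condition, LUWSMC.) There are $\alpha>0$ and $\varepsilon>0$ such that $\alpha\operatorname{dist}(y,S(x))\le f(x,y)-\varphi(x)$ for all $(x,y)$ with $y\in\Gamma(x)$ and $\|(x,y)-(\bar x,\bar y)\|_\infty<\varepsilon$. 3. (Partial calmness.)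 Let $F\colon\mathbb R^n\times\mathbb R^m\to\mathbb R$ be locally Lipschitz continuous, let $X\subset\mathbb R^n$ be nonempty and closed, and suppose that $(\bar x,\bar y)$ is a local minimizer of $\min_{x,y}\{F(x,y) : x\in X,\ y\in S(x)\}$. Then there are $\delta>0$ and $\bar\kappa>0$ such that $F(x,y)+\bar\kappa|u|\ge F(\bar x,\bar y)$ for all $(x,y,u)$ with $\|(x,y,u)-(\bar x,\bar y,0)\|_\infty\le\delta$, $x\in X$, $f(x,y)-\varphi(x)\le u$ and $g(x,y)\le 0$. -/

import Mathlib

open Set Filter Topology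

namespace Bilevel

/-- Vectors of length `k`, carrying the maximum norm. -/
abbrev Vec (k : ℕ) : Type := Fin k → ℝ

/-- The domain of a set-valued mapping. -/
def dom {n m : ℕ} (Υ : Vec n → Set (Vec m)) : Set (Vec n) := {x | (Υ x).Nonempty}

/-- The graph of a set-valued mapping. -/
def gph {n m : ℕ} (Υ : Vec n → Set (Vec m)) : Set (Vec n × Vec m) := {p | p.2 ∈ Υ p.1}

/-- Inner semicontinuity of a set-valued mapping at a point `(xb, yb)` of its graph: every
sequence `x_k → xb` admits a sequence `y_k → yb` with `y_k ∈ Υ x_k` for all large `k`. -/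
def InnerSemicontinuousAt {n m : ℕ} (Υ : Vec n → Set (Vec m)) (xb : Vec n) (yb : Vec m) : Prop :=
  ∀ x : ℕ → Vec n, Tendsto x atTop (𝓝 xb) →
    ∃ y : ℕ → Vec m, Tendsto y atTop (𝓝 yb) ∧ ∀ᶠ k in atTop, y k ∈ Υ (x k)

/-- The distance of a point to a set, with value `+∞` for the empty set. -/
noncomputable def setDist {m : ℕ} (y : Vec m) (s : Set (Vec m)) : EReal :=
  ((Metric.infEDist y s : ENNReal) : EReal)

/-- The set-valued mapping described by the inequality constraints `h i x y ≤ 0`. The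
constraint functions may be extended-real-valued since optimal values enter them. -/
def constraintMap {n m : ℕ} {ι : Type} (h : ι → Vec n → Vec m → EReal) (x : Vec n) :
    Set (Vec m) :=
  {y | ∀ i, h i x y ≤ 0}

/-- R-regularity at `(xb, yb)` with respect to `Ω` of the mapping described by `h i x y ≤ 0`. -/
def RRegularAt {n m : ℕ} {ι : Type} (h : ι → Vec n → Vec m → EReal) (Ω : Set (Vec n))
    (xb : Vec n) (yb : Vec m) : Prop :=
  ∃ κ : ℝ, 0 < κ ∧ ∃ ε : ℝ, 0 < ε ∧ ∀ x : Vec n, ∀ y : Vec m,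
    (x, y) ∈ Metric.ball (xb, yb) ε → x ∈ Ω →
      setDist y (constraintMap h x) ≤ (κ : EReal) * max 0 (⨆ i, h i x y)

section LowerLevel

variable {n m q : ℕ} (f : Vec n → Vec m → ℝ) (g : Vec n → Vec m → Fin q → ℝ)

/-- The feasible set mapping of the lower level problem. -/
def Gam (x : Vec n) : Set (Vec m) := {y | ∀ i, g x y i ≤ 0}

/-- The solution mapping of the lower level problem `min_y {f x y | g x y ≤ 0}`. -/
def Sol (x : Vec n) : Set (Vec m) := {y | y ∈ Gam g x ∧ ∀ z ∈ Gam g x, f x y ≤ f x z}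

/-- The optimal value function: `+∞` if the problem is infeasible, `-∞` if it is unbounded. -/
noncomputable def optVal (x : Vec n) : EReal := ⨅ y ∈ Gam g x, ((f x y : ℝ) : EReal)

/-- The constraint functions of the optimal value description of the solution set:
`f x y - optVal x` (index `none`) and the components of `g` (indices `some i`). -/
noncomputable def valueConstraints : Option (Fin q) → Vec n → Vec m → EReal
  | none, x, y => ((f x y : ℝ) : EReal) - optVal f g x
  | some i, x, y => ((g x y i : ℝ) : EReal)

/-- The mapping `x ↦ {y | f x y - optVal x ≤ 0, g x y ≤ 0}`. -/
noncomputable def Phi : Vec n → Set (Vec m) := constraintMap (valueConstraints f g)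

/-- The local uniformly weak sharp minimum condition at `(xb, yb)`. -/
def LUWSMC (xb : Vec n) (yb : Vec m) : Prop :=
  ∃ α : ℝ, 0 < α ∧ ∃ ε : ℝ, 0 < ε ∧
    ∀ p ∈ gph (Gam g) ∩ Metric.ball (xb, yb) ε,
      (α : EReal) * setDist p.2 (Sol f g p.1) ≤ ((f p.1 p.2 : ℝ) : EReal) - optVal f g p.1

/-- The R-regularity constraint qualification at `(xb, yb)`: the mapping `Phi` is R-regular at
`(xb, yb)` with respect to its domain. As R-regularity is a notion for mappings described by
(real-valued) continuous functions, the optimal value function is required to be finite and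
continuous around `xb`. -/
def RRCQ (xb : Vec n) (yb : Vec m) : Prop :=
  (∃ V ∈ 𝓝 xb, ContinuousOn (optVal f g) V ∧ ∀ x ∈ V, optVal f g x ≠ ⊥ ∧ optVal f g x ≠ ⊤) ∧
    RRegularAt (valueConstraints f g) (dom (Phi f g)) xb yb

/-- `(xb, yb)` is a local minimizer of the bilevel problem
`min {F (x, y) | x ∈ X, y ∈ S(x)}`. -/
def IsLocalMinimizerBPP (F : Vec n × Vec m → ℝ) (X : Set (Vec n))
    (xb : Vec n) (yb : Vec m) : Prop :=
  xb ∈ X ∧ yb ∈ Sol f g xb ∧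
    ∃ γ : ℝ, 0 < γ ∧ ∀ x : Vec n, ∀ y : Vec m, (x, y) ∈ Metric.ball (xb, yb) γ →
      x ∈ X → y ∈ Sol f g x → F (xb, yb) ≤ F (x, y)

/-- Partial calmness of the bilevel problem at (its local minimizer) `(xb, yb)`. -/
def PartiallyCalm (F : Vec n × Vec m → ℝ) (X : Set (Vec n)) (xb : Vec n) (yb : Vec m) : Prop :=
  ∃ δ : ℝ, 0 < δ ∧ ∃ κ : ℝ, 0 < κ ∧ ∀ x : Vec n, ∀ y : Vec m, ∀ u : ℝ,
    (x, y, u) ∈ Metric.closedBall (xb, yb, (0 : ℝ)) δ →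
      x ∈ X → ((f x y : ℝ) : EReal) - optVal f g x ≤ (u : EReal) → (∀ i, g x y i ≤ 0) →
        F (xb, yb) ≤ F (x, y) + κ * |u|

end LowerLevel

section Linear

open scoped Matrix

variable {n m q : ℕ} (c : Vec n → Vec m) (A : Vec n → Vec q)
  (B : Vec n → Matrix (Fin q) (Fin m) ℝ)

/-- The objective `c(x)ᵀ y`. -/
def linObj (x : Vec n) (y : Vec m) : ℝ := c x ⬝ᵥ y

/-- The constraint function `A(x) + B(x) y`. -/
def linCon (x : Vec n) (y : Vec m) : Fin q → ℝ := A x + B x *ᵥ y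

/-- The index set of the constraints which are active at `(xb, yb)`. -/
def activeSet (xb : Vec n) (yb : Vec m) : Set (Fin q) := {i | linCon A B xb yb i = 0}

/-- The matrix with first row `c(x)ᵀ` followed by the rows of `B(x)` with index in `I`. -/
def augMatrix (I : Set (Fin q)) (x : Vec n) : Matrix (Unit ⊕ I) (Fin m) ℝ :=
  Matrix.fromRows (Matrix.replicateRow Unit (c x)) ((B x).submatrix (fun i : I => (i : Fin q)) id)

/-- Every row submatrix of `augMatrix` has constant rank on one common neighbourhood of `xb`. -/
def ConstantRankNear (I : Set (Fin q)) (xb : Vec n) : Prop :=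
  ∃ U ∈ 𝓝 xb, ∀ J : Set (Unit ⊕ I), ∀ x ∈ U, ∀ x' ∈ U,
    ((augMatrix c B I x).submatrix (fun j : J => (j : Unit ⊕ I)) id).rank =
      ((augMatrix c B I x').submatrix (fun j : J => (j : Unit ⊕ I)) id).rank

end Linear

end Bilevel

/-! For `x` near `xb`, `S(x)` is the polyhedron `c(x)·y ≤ φ(x)`, `B(x) y ≤ -A(x)`. All three
qualifications follow from one Hoffman bound, `dist(y, S(x)) ≤ κ r` whenever `r ≥ 0` dominates all
residuals at `y`, with `κ` independent of `(x, y)` near `(xb, yb)` (`SolutionErrorBound`).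

Uniformity of `κ` is the crux (`exists_uniform_hoffman`). If `p` is the Euclidean projection of `y`,
then `y - p = ∑ wᵢ aᵢ` with `wᵢ ≥ 0` and linearly independent rows `aᵢ` active at `p` (Farkas and
Carathéodory). Hence `‖y - p‖² = ∑ wᵢ ⟪aᵢ, y - p⟫ ≤ (∑ wᵢ) r`, and it remains to bound `∑ wᵢ` by a
multiple of `‖y - p‖`. Inner semicontinuity keeps `p` near `yb`, so only the objective row and rows
of `I` occur. By constant rank these rows are also independent at `xb`, where each of the finitely
many independent families has a coefficient bound stable under perturbation. Continuity of `φ` is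
never needed here.

Continuity of `φ` is proved separately: the same bound for the constraints alone gives lower
semicontinuity of `Γ`, hence upper semicontinuity of `φ`; lower semicontinuity uses solutions
confined to a compact ball. -/

namespace Bilevel

/-! ### Finitely generated cones and projections onto polyhedra -/

section Cone

open scoped RealInnerProductSpace

/-- Conic version of Carathéodory's theorem. -/
theorem exists_linearIndepOn_nonneg_combination {ι E : Type*} [AddCommGroup E] [Module ℝ E]
    (v : ι → E) (s : Finset ι) (w : ι → ℝ) (hw : ∀ i, 0 ≤ w i) :
    ∃ t ⊆ s, LinearIndepOn ℝ v (t : Set ι) ∧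
      ∃ w' : ι → ℝ, (∀ i, 0 ≤ w' i) ∧ ∑ i ∈ t, w' i • v i = ∑ i ∈ s, w i • v i := by
  classical
  induction hn : s.card using Nat.strong_induction_on generalizing s w with
  | _ N ih =>
  by_cases hli : LinearIndepOn ℝ v (s : Set ι)
  · exact ⟨s, subset_rfl, hli, w, hw, rfl⟩
  obtain ⟨g, hg0, j, hj, hgj⟩ : ∃ g : ι → ℝ, ∑ i ∈ s, g i • v i = 0 ∧ ∃ j ∈ s, 0 < g j := by
    rw [linearIndepOn_finset_iff] at hli
    push Not at hli
    obtain ⟨g, hg0, j, hj, hgj⟩ := hli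
    rcases lt_or_gt_of_ne hgj with h | h
    · exact ⟨-g, by simp [hg0], j, hj, by simpa using h⟩
    · exact ⟨g, hg0, j, hj, h⟩
  -- Ratio test: moving along the dependence `g` by the smallest ratio keeps all weights nonnegative
  -- and annihilates the one at `k`.
  obtain ⟨k, hk, hmin⟩ := (s.filter (0 < g ·)).exists_min_image (fun i => w i / g i)
    ⟨j, by simp [hj, hgj]⟩
  obtain ⟨hks, hgk⟩ := Finset.mem_filter.1 hk
  have hθ : 0 ≤ w k / g k := div_nonneg (hw k) hgk.le
  have hw2 : ∀ i ∈ s, 0 ≤ w i - w k / g k * g i := by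
    intro i hi
    rcases le_or_gt (g i) 0 with h | h
    · nlinarith [hw i, mul_nonneg hθ (neg_nonneg.2 h)]
    · have := hmin i (by simp [hi, h])
      rw [le_div_iff₀ h] at this
      linarith
  have hwk : w k - w k / g k * g k = 0 := by field_simp; simp
  obtain ⟨t, hts, hli', w', hw', hsum⟩ := ih (s.erase k).card
    (hn ▸ Finset.card_erase_lt_of_mem hks) (s.erase k)
    -- The truncation changes nothing on `s`; it only secures nonnegativity at indices outside `s`.
    (fun i => max 0 (w i - w k / g k * g i)) (fun i => le_max_left _ _) rfl
  refine ⟨t, hts.trans (Finset.erase_subset _ _), hli', w', hw', hsum.trans ?_⟩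
  calc ∑ i ∈ s.erase k, max 0 (w i - w k / g k * g i) • v i
      = ∑ i ∈ s.erase k, (w i - w k / g k * g i) • v i :=
        Finset.sum_congr rfl fun i hi => by rw [max_eq_right (hw2 i (Finset.mem_of_mem_erase hi))]
    _ = ∑ i ∈ s, (w i - w k / g k * g i) • v i :=
        Finset.sum_erase _ (by rw [hwk, zero_smul])
    _ = ∑ i ∈ s, w i • v i := by
        simp only [sub_smul, Finset.sum_sub_distrib, mul_smul, ← Finset.smul_sum, hg0, smul_zero,
          sub_zero]

/-- Finitely generated convex cones are closed. -/
theorem isClosed_nonneg_combinations {ι E : Type*} [NormedAddCommGroup E]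
    [InnerProductSpace ℝ E] (v : ι → E) (s : Finset ι) :
    IsClosed {u : E | ∃ w : ι → ℝ, (∀ i, 0 ≤ w i) ∧ ∑ i ∈ s, w i • v i = u} := by
  classical
  -- By Carathéodory the cone is a finite union of images of closed orthants under injective linear
  -- maps, each of which is a closed embedding.
  have key : {u : E | ∃ w : ι → ℝ, (∀ i, 0 ≤ w i) ∧ ∑ i ∈ s, w i • v i = u} =
      ⋃ t ∈ {t | t ∈ s.powerset ∧ LinearIndepOn ℝ v (t : Set ι)},
        Fintype.linearCombination ℝ (fun i : t => v i) '' {w | ∀ i, 0 ≤ w i} := by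
    ext u
    simp only [mem_ofPred_eq, Finset.mem_powerset, mem_iUnion, mem_image, exists_prop,
      Fintype.linearCombination_apply]
    constructor
    · rintro ⟨w, hw, rfl⟩
      obtain ⟨t, hts, hli, w', hw', h⟩ := exists_linearIndepOn_nonneg_combination v s w hw
      exact ⟨t, ⟨hts, hli⟩, fun i => w' i, fun i => hw' i,
        (Finset.sum_coe_sort t fun i => w' i • v i).trans h⟩
    · rintro ⟨t, ⟨hts, -⟩, w, hw, rfl⟩
      refine ⟨fun i => if h : i ∈ t then w ⟨i, h⟩ else 0, fun i => ?_, ?_⟩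
      · dsimp only; split_ifs
        exacts [hw _, le_rfl]
      · rw [← Finset.sum_subset hts (fun i _ hi => by simp [hi]), ← Finset.sum_coe_sort]
        exact Finset.sum_congr rfl fun i _ => by simp
  rw [key]
  refine Set.Finite.isClosed_biUnion
    (s.powerset.finite_toSet.subset fun t ht => ht.1) fun t ht => ?_
  have hinj : LinearMap.ker (Fintype.linearCombination ℝ (fun i : t => v i)) = ⊥ :=
    LinearMap.ker_eq_bot.2 ht.2.fintypeLinearCombination_injective
  refine (LinearMap.isClosedEmbedding_of_injective hinj).isClosedMap _ ?_
  simp only [ofPred_forall]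
  exact isClosed_iInter fun i => isClosed_le continuous_const (continuous_apply i)

/-- **Farkas' lemma**. -/
theorem exists_nonneg_combination_of_inner_nonpos {ι E : Type*} [NormedAddCommGroup E]
    [InnerProductSpace ℝ E] [CompleteSpace E] (v : ι → E) (s : Finset ι) (u : E)
    (h : ∀ t : E, (∀ i ∈ s, ⟪v i, t⟫ ≤ 0) → ⟪u, t⟫ ≤ 0) :
    ∃ w : ι → ℝ, (∀ i, 0 ≤ w i) ∧ ∑ i ∈ s, w i • v i = u := by
  classical
  set K : Set E := {u : E | ∃ w : ι → ℝ, (∀ i, 0 ≤ w i) ∧ ∑ i ∈ s, w i • v i = u} with hK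
  have hconv : Convex ℝ K := by
    rintro _ ⟨w, hw, rfl⟩ _ ⟨w', hw', rfl⟩ a b ha hb -
    refine ⟨fun i => a * w i + b * w' i, fun i => ?_, ?_⟩
    · exact add_nonneg (mul_nonneg ha (hw i)) (mul_nonneg hb (hw' i))
    · simp only [add_smul, Finset.sum_add_distrib, mul_smul, Finset.smul_sum]
  obtain ⟨p, hpK, hp⟩ := exists_norm_eq_iInf_of_complete_convex (K := K)
    ⟨0, 0, fun i => le_rfl, by simp⟩ (isClosed_nonneg_combinations v s).isComplete hconv u
  rw [norm_eq_iInf_iff_real_inner_le_zero hconv hpK] at hp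
  obtain ⟨w, hw, hwp⟩ := hpK
  -- Testing the projection inequality at `p + v i` makes `u - p` admissible in `h`; testing it at
  -- `0` gives `0 ≤ ⟪u - p, p⟫`. Together they force `‖u - p‖² ≤ 0`.
  have h1 : ∀ i ∈ s, ⟪v i, u - p⟫ ≤ 0 := by
    intro i hi
    have := hp (p + v i) ⟨fun j => w j + if j = i then 1 else 0,
      fun j => add_nonneg (hw j) (by split_ifs <;> norm_num),
      by simp [add_smul, Finset.sum_add_distrib, hwp, hi]⟩
    rwa [add_sub_cancel_left, real_inner_comm] at this
  have h2 : 0 ≤ ⟪u - p, p⟫ := by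
    have := hp 0 ⟨0, fun i => le_rfl, by simp⟩
    rw [zero_sub, inner_neg_right] at this
    linarith
  have h3 := h _ h1
  have h4 : ⟪u - p, u - p⟫ ≤ 0 := by
    rw [inner_sub_right, real_inner_comm]; linarith
  have h5 : u - p = 0 := real_inner_self_nonpos.1 h4
  exact ⟨w, hw, by rw [hwp]; exact (sub_eq_zero.1 h5).symm⟩

/-- The projection residual of a point on a polyhedron is a nonnegative combination of linearly
independent normals of active constraints. -/
theorem exists_projection_polyhedron {ι E : Type*} [Finite ι] [NormedAddCommGroup E]
    [InnerProductSpace ℝ E] [CompleteSpace E] (a : ι → E) (b : ι → ℝ) (y : E)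
    (hne : ∃ p, ∀ i, ⟪a i, p⟫ ≤ b i) :
    ∃ p, (∀ i, ⟪a i, p⟫ ≤ b i) ∧ (∀ z, (∀ i, ⟪a i, z⟫ ≤ b i) → ‖y - p‖ ≤ ‖y - z‖) ∧
      ∃ t : Finset ι, (∀ i ∈ t, ⟪a i, p⟫ = b i) ∧ LinearIndepOn ℝ a (t : Set ι) ∧
        ∃ w : ι → ℝ, (∀ i, 0 ≤ w i) ∧ ∑ i ∈ t, w i • a i = y - p := by
  classical
  have := Fintype.ofFinite ι
  set P : Set E := {p | ∀ i, ⟪a i, p⟫ ≤ b i} with hP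
  have hclosed : IsClosed P := by
    simp only [hP, ofPred_forall]
    exact isClosed_iInter fun i => isClosed_le (by fun_prop) continuous_const
  have hconv : Convex ℝ P := by
    intro x hx z hz α β hα hβ hαβ i
    rw [inner_add_right, inner_smul_right, inner_smul_right]
    calc α * ⟪a i, x⟫ + β * ⟪a i, z⟫ ≤ α * b i + β * b i :=
          add_le_add (mul_le_mul_of_nonneg_left (hx i) hα) (mul_le_mul_of_nonneg_left (hz i) hβ)
      _ = b i := by rw [← add_mul, hαβ, one_mul]
  obtain ⟨p, hpP, hpmin⟩ := exists_norm_eq_iInf_of_complete_convex hne hclosed.isComplete hconv y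
  have hp := (norm_eq_iInf_iff_real_inner_le_zero hconv hpP).1 hpmin
  refine ⟨p, hpP, fun z hz => ?_, ?_⟩
  · rw [hpmin]
    exact ciInf_le ⟨0, by rintro _ ⟨z, rfl⟩; exact norm_nonneg _⟩ (⟨z, hz⟩ : P)
  -- A direction that increases no active constraint stays feasible for a short time, so the
  -- projection inequality applies to it; Farkas then uses active normals only.
  have hdir : ∀ t : E, (∀ i ∈ Finset.univ.filter (fun i => ⟪a i, p⟫ = b i), ⟪a i, t⟫ ≤ 0) →
      ⟪y - p, t⟫ ≤ 0 := by
    intro t ht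
    have hev : ∀ᶠ r : ℝ in 𝓝[>] 0, ∀ i, ⟪a i, p + r • t⟫ ≤ b i := by
      rw [eventually_all]
      intro i
      by_cases hi : ⟪a i, p⟫ = b i
      · filter_upwards [self_mem_nhdsWithin] with r hr
        rw [inner_add_right, inner_smul_right, hi]
        have := mul_nonpos_of_nonneg_of_nonpos (le_of_lt hr) (ht i (by simp [hi]))
        linarith
      · have hlt : ⟪a i, p + (0 : ℝ) • t⟫ < b i := by
          simpa using lt_of_le_of_ne (hpP i) hi
        have hcont : Continuous fun r : ℝ => ⟪a i, p + r • t⟫ := by fun_prop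
        exact ((hcont.continuousAt.eventually_lt_const hlt).filter_mono nhdsWithin_le_nhds).mono
          fun r hr => hr.le
    obtain ⟨r, hr, hr0⟩ := (hev.and self_mem_nhdsWithin).exists
    have := hp _ hr
    rw [add_sub_cancel_left, inner_smul_right] at this
    exact nonpos_of_mul_nonpos_right this hr0
  obtain ⟨w, hw, hsum⟩ := exists_nonneg_combination_of_inner_nonpos a _ _ hdir
  obtain ⟨t, hts, hli, w', hw', hsum'⟩ := exists_linearIndepOn_nonneg_combination a _ w hw
  exact ⟨t, fun i hi => (Finset.mem_filter.1 (hts hi)).2, hli, w', hw', hsum'.trans hsum⟩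

/-! ### Hoffman bounds uniform in the parameter -/

/-- Linear independence at a point gives a locally uniform bound for coefficients. -/
theorem eventually_sum_le_norm_combination {ι X E : Type*} [TopologicalSpace X]
    [NormedAddCommGroup E] [InnerProductSpace ℝ E] (M : X → ι → E) (xb : X)
    (hM : ∀ i, ContinuousAt (fun x => M x i) xb) (t : Finset ι)
    (hli : LinearIndepOn ℝ (M xb) (t : Set ι)) :
    ∃ C : ℝ, 0 ≤ C ∧ ∀ᶠ x in 𝓝 xb, ∀ w : ι → ℝ, (∀ i, 0 ≤ w i) →
      ∑ i ∈ t, w i ≤ C * ‖∑ i ∈ t, w i • M x i‖ := by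
  classical
  obtain ⟨K, hK, hanti⟩ := (LinearMap.injective_iff_antilipschitz
    (Fintype.linearCombination ℝ (fun i : t => M xb i))).1 hli.fintypeLinearCombination_injective
  have hbound : ∀ w : ι → ℝ, (∀ i, 0 ≤ w i) → ∑ i ∈ t, w i ≤
      (t.card * K) * ‖∑ i ∈ t, w i • M xb i‖ := by
    intro w hw
    have h := hanti.le_mul_dist (fun i : t => w i) 0
    rw [map_zero, dist_zero_right, dist_zero_right, Fintype.linearCombination_apply,
      Finset.sum_coe_sort t fun i => w i • M xb i] at h
    calc ∑ i ∈ t, w i ≤ ∑ _i ∈ t, ‖fun i : t => w i‖ := by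
          refine Finset.sum_le_sum fun i hi => ?_
          exact (le_abs_self _).trans (norm_le_pi_norm (fun i : t => w i) ⟨i, hi⟩)
      _ = t.card * ‖fun i : t => w i‖ := by simp
      _ ≤ t.card * (K * ‖∑ i ∈ t, w i • M xb i‖) := by gcongr
      _ = _ := by ring
  set D : ℝ := t.card * K with hD
  have hD0 : 0 ≤ D := by positivity
  -- The factor 2 pays for the perturbation of the rows, which costs at most half of `∑ w` and is
  -- absorbed on the left.
  refine ⟨2 * D, by positivity, ?_⟩
  have hnear : ∀ᶠ x in 𝓝 xb, ∀ i ∈ t, D * ‖M xb i - M x i‖ ≤ 1 / 2 := by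
    rw [Finset.eventually_all]
    intro i _
    have hc : ContinuousAt (fun x => D * ‖M xb i - M x i‖) xb :=
      ((continuousAt_const.sub (hM i)).norm).const_mul D
    exact (hc.eventually_lt_const (by simp)).mono fun x hx => hx.le
  filter_upwards [hnear] with x hx w hw
  have h1 := hbound w hw
  have h2 : ‖∑ i ∈ t, w i • M xb i‖ ≤
      ‖∑ i ∈ t, w i • M x i‖ + ∑ i ∈ t, w i * ‖M xb i - M x i‖ := by
    have : ∑ i ∈ t, w i • M xb i =
        ∑ i ∈ t, w i • M x i + ∑ i ∈ t, w i • (M xb i - M x i) := by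
      simp [smul_sub]
    rw [this]
    refine (norm_add_le _ _).trans (add_le_add_right ((norm_sum_le _ _).trans ?_) _)
    exact Finset.sum_le_sum fun i _ => by rw [norm_smul, Real.norm_of_nonneg (hw i)]
  have h3 : D * ∑ i ∈ t, w i * ‖M xb i - M x i‖ ≤ 1 / 2 * ∑ i ∈ t, w i := by
    rw [Finset.mul_sum, Finset.mul_sum]
    refine Finset.sum_le_sum fun i hi => ?_
    nlinarith [hx i hi, hw i]
  nlinarith [mul_le_mul_of_nonneg_left h2 hD0]

/-- A locally uniform Hoffman error bound for a parametric polyhedron whose linearly independent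
subsystems of locally relevant rows stay linearly independent at the reference point. -/
theorem exists_uniform_hoffman {ι X E : Type*} [Finite ι] [TopologicalSpace X]
    [NormedAddCommGroup E] [InnerProductSpace ℝ E] [CompleteSpace E]
    (M : X → ι → E) (d : X → ι → ℝ) (I : Set ι) (xb : X) (yb : E)
    (hM : ∀ i, ContinuousAt (fun x => M x i) xb)
    (hI : ∀ i ∉ I, ∀ᶠ z : X × E in 𝓝 (xb, yb), ⟪M z.1 i, z.2⟫ < d z.1 i)
    (hrank : ∀ᶠ x in 𝓝 xb, ∀ t : Finset ι, (t : Set ι) ⊆ I →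
      LinearIndepOn ℝ (M x) (t : Set ι) → LinearIndepOn ℝ (M xb) (t : Set ι))
    (hisc : ∀ ε > 0, ∀ᶠ x in 𝓝 xb, ∃ p, ‖p - yb‖ < ε ∧ ∀ i, ⟪M x i, p⟫ ≤ d x i) :
    ∃ κ : ℝ, 0 < κ ∧ ∀ᶠ z : X × E in 𝓝 (xb, yb), ∀ r, 0 ≤ r →
      (∀ i, ⟪M z.1 i, z.2⟫ - d z.1 i ≤ r) →
      ∃ p, (∀ i, ⟪M z.1 i, p⟫ ≤ d z.1 i) ∧ ‖z.2 - p‖ ≤ κ * r := by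
  classical
  have := Fintype.ofFinite ι
  have hC : ∀ t : Finset ι, ∃ C : ℝ, 0 ≤ C ∧ (LinearIndepOn ℝ (M xb) (t : Set ι) →
      ∀ᶠ x in 𝓝 xb, ∀ w : ι → ℝ, (∀ i, 0 ≤ w i) →
        ∑ i ∈ t, w i ≤ C * ‖∑ i ∈ t, w i • M x i‖) := by
    intro t
    by_cases hli : LinearIndepOn ℝ (M xb) (t : Set ι)
    · obtain ⟨C, hC, h⟩ := eventually_sum_le_norm_combination M xb hM t hli
      exact ⟨C, hC, fun _ => h⟩
    · exact ⟨0, le_rfl, fun h => absurd h hli⟩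
  choose C hC0 hC using hC
  have hev1 : ∀ᶠ x in 𝓝 xb, ∀ t : Finset ι, LinearIndepOn ℝ (M xb) (t : Set ι) →
      ∀ w : ι → ℝ, (∀ i, 0 ≤ w i) → ∑ i ∈ t, w i ≤ C t * ‖∑ i ∈ t, w i • M x i‖ := by
    rw [eventually_all]
    intro t
    by_cases hli : LinearIndepOn ℝ (M xb) (t : Set ι)
    · filter_upwards [hC t hli] with x hx _ using hx
    · exact Eventually.of_forall fun x h => absurd h hli
  have hev2 : ∀ᶠ z : X × E in 𝓝 (xb, yb), ∀ i, i ∉ I → ⟪M z.1 i, z.2⟫ < d z.1 i := by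
    rw [eventually_all]
    intro i
    by_cases hi : i ∈ I
    · exact Eventually.of_forall fun z h => absurd hi h
    · filter_upwards [hI i hi] with z hz _ using hz
  rw [nhds_prod_eq] at hev2
  obtain ⟨pa, hpa, pb, hpb, hab⟩ := eventually_prod_iff.1 hev2
  obtain ⟨ε, hε, hball⟩ := Metric.eventually_nhds_iff.1 hpb
  -- One constant dominating every `C t`; the 1 makes it positive.
  set κ : ℝ := 1 + ∑ t, C t with hκ
  have hκt : ∀ t, C t ≤ κ := fun t => by
    have := Finset.single_le_sum (fun t _ => hC0 t) (Finset.mem_univ t)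
    linarith
  have hκ0 : 0 < κ := by
    have := Finset.sum_nonneg fun t (_ : t ∈ Finset.univ) => hC0 t
    linarith
  refine ⟨κ, hκ0, ?_⟩
  have hfst : Tendsto Prod.fst (𝓝 (xb, yb)) (𝓝 xb) := continuous_fst.tendsto _
  have hsnd : Tendsto Prod.snd (𝓝 (xb, yb)) (𝓝 yb) := continuous_snd.tendsto _
  filter_upwards [hfst.eventually hev1, hfst.eventually hrank, hfst.eventually hpa,
    -- With `y` and some feasible `p₀` within `ε / 3` of `yb`, the projection of `y` lies within `ε`
    -- of `yb`, where constraints outside `I` are strict.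
    hfst.eventually (hisc (ε / 3) (by positivity)),
    hsnd.eventually (Metric.ball_mem_nhds yb (show 0 < ε / 3 by positivity))]
  rintro ⟨x, y⟩ h1 hrk hx ⟨p₀, hp₀, hp₀P⟩ hy r hr hres
  dsimp only at *
  obtain ⟨p, hpP, hpmin, t, hact, hli, w, hw, hsum⟩ :=
    exists_projection_polyhedron (M x) (d x) y ⟨p₀, hp₀P⟩
  refine ⟨p, hpP, ?_⟩
  have hy' : ‖y - yb‖ < ε / 3 := mem_ball_iff_norm.1 hy
  have hpyb : dist p yb < ε := by
    rw [dist_eq_norm]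
    have e1 : ‖p - yb‖ ≤ ‖y - p‖ + ‖y - yb‖ := by
      rw [norm_sub_rev y p]; exact norm_sub_le_norm_sub_add_norm_sub p y yb
    have e2 : ‖y - p₀‖ ≤ ‖y - yb‖ + ‖p₀ - yb‖ := by
      rw [norm_sub_rev p₀ yb]; exact norm_sub_le_norm_sub_add_norm_sub y yb p₀
    linarith [hpmin p₀ hp₀P]
  have htI : (t : Set ι) ⊆ I := by
    intro i hi
    by_contra hiI
    exact (hab hx (hball hpyb) i hiI).ne (hact i hi)
  have h2 := h1 t (hrk t htI hli) w hw
  rw [hsum] at h2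
  have h3 : ‖y - p‖ * ‖y - p‖ ≤ (∑ i ∈ t, w i) * r := by
    rw [← real_inner_self_eq_norm_mul_norm]
    nth_rewrite 1 [← hsum]
    rw [sum_inner, Finset.sum_mul]
    refine Finset.sum_le_sum fun i hi => ?_
    rw [real_inner_smul_left, inner_sub_right, hact i hi]
    exact mul_le_mul_of_nonneg_left (hres i) (hw i)
  rcases eq_or_lt_of_le (norm_nonneg (y - p)) with h0 | h0
  · rw [← h0]; positivity
  · have h4 : ‖y - p‖ * ‖y - p‖ ≤ (κ * r) * ‖y - p‖ := by
      calc _ ≤ (∑ i ∈ t, w i) * r := h3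
        _ ≤ (C t * ‖y - p‖) * r := mul_le_mul_of_nonneg_right h2 hr
        _ ≤ (κ * ‖y - p‖) * r := by gcongr; exact hκt t
        _ = _ := by ring
    exact le_of_mul_le_mul_right h4 h0

end Cone

/-! ### Error bounds in the maximum norm and their consequences -/

section ErrorBound

variable {n m q : ℕ}

/-- `exists_uniform_hoffman` in coordinates, with the maximum norm. -/
theorem exists_uniform_hoffman_vec {ι X : Type*} [Finite ι] [TopologicalSpace X]
    (M : X → ι → Vec m) (d : X → ι → ℝ) (I : Set ι) (xb : X) (yb : Vec m)
    (hM : ∀ i, ContinuousAt (fun x => M x i) xb)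
    (hI : ∀ i ∉ I, ∀ᶠ z : X × Vec m in 𝓝 (xb, yb), M z.1 i ⬝ᵥ z.2 < d z.1 i)
    (hrank : ∀ᶠ x in 𝓝 xb, ∀ t : Finset ι, (t : Set ι) ⊆ I →
      LinearIndepOn ℝ (M x) (t : Set ι) → LinearIndepOn ℝ (M xb) (t : Set ι))
    (hisc : ∀ V ∈ 𝓝 yb, ∀ᶠ x in 𝓝 xb, ∃ p ∈ V, ∀ i, M x i ⬝ᵥ p ≤ d x i) :
    ∃ κ : ℝ, 0 < κ ∧ ∀ᶠ z : X × Vec m in 𝓝 (xb, yb), ∀ r, 0 ≤ r →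
      (∀ i, M z.1 i ⬝ᵥ z.2 - d z.1 i ≤ r) →
      ∃ p, (∀ i, M z.1 i ⬝ᵥ p ≤ d z.1 i) ∧ ‖z.2 - p‖ ≤ κ * r := by
  have hinner : ∀ (a : Vec m) (p : EuclideanSpace ℝ (Fin m)),
      inner ℝ (WithLp.toLp 2 a) p = a ⬝ᵥ p.ofLp := by
    intro a p
    rw [EuclideanSpace.inner_eq_star_dotProduct, dotProduct_comm]
    simp
  have hto : Continuous (WithLp.toLp 2 : Vec m → EuclideanSpace ℝ (Fin m)) :=
    PiLp.continuous_toLp 2 _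
  have hof : Continuous (WithLp.ofLp : EuclideanSpace ℝ (Fin m) → Vec m) :=
    PiLp.continuous_ofLp 2 _
  have hli : ∀ x (s : Set ι), LinearIndepOn ℝ (fun i => WithLp.toLp 2 (M x i)) s ↔
      LinearIndepOn ℝ (M x) s := fun x s =>
    LinearMap.linearIndepOn_iff_of_injOn (WithLp.linearEquiv 2 ℝ (Vec m)).symm.toLinearMap
      (WithLp.linearEquiv 2 ℝ (Vec m)).symm.injective.injOn
  have hI' : ∀ i ∉ I, ∀ᶠ z : X × EuclideanSpace ℝ (Fin m) in 𝓝 (xb, WithLp.toLp 2 yb),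
      inner ℝ (WithLp.toLp 2 (M z.1 i)) z.2 < d z.1 i := by
    intro i hi
    have ht : Tendsto (fun z : X × EuclideanSpace ℝ (Fin m) => (z.1, z.2.ofLp))
        (𝓝 (xb, WithLp.toLp 2 yb)) (𝓝 (xb, yb)) :=
      (continuous_fst.prodMk (hof.comp continuous_snd)).tendsto (xb, WithLp.toLp 2 yb)
    filter_upwards [ht.eventually (hI i hi)] with z hz
    simpa only [hinner] using hz
  have hisc' : ∀ ε > 0, ∀ᶠ x in 𝓝 xb, ∃ p, ‖p - WithLp.toLp 2 yb‖ < ε ∧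
      ∀ i, inner ℝ (WithLp.toLp 2 (M x i)) p ≤ d x i := by
    intro ε hε
    have hV : {p | ‖WithLp.toLp 2 p - WithLp.toLp 2 yb‖ < ε} ∈ 𝓝 yb := by
      have : Continuous fun p : Vec m => ‖WithLp.toLp 2 p - WithLp.toLp 2 yb‖ := by fun_prop
      exact (this.tendsto yb).eventually_lt_const (by simpa using hε)
    filter_upwards [hisc _ hV] with x ⟨p, hpV, hp⟩
    exact ⟨WithLp.toLp 2 p, hpV, fun i => by simpa only [hinner] using hp i⟩
  obtain ⟨κ, hκ, h⟩ := exists_uniform_hoffman (fun x i => WithLp.toLp 2 (M x i)) d I xb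
    (WithLp.toLp 2 yb) (fun i => hto.continuousAt.comp (hM i)) hI'
    (hrank.mono fun x hx t ht h => (hli _ _).2 (hx t ht ((hli _ _).1 h))) hisc'
  refine ⟨κ, hκ, ?_⟩
  have ht : Tendsto (fun z : X × Vec m => (z.1, WithLp.toLp 2 z.2)) (𝓝 (xb, yb))
      (𝓝 (xb, WithLp.toLp 2 yb)) :=
    (continuous_fst.prodMk (hto.comp continuous_snd)).tendsto (xb, yb)
  filter_upwards [ht.eventually h] with z hz r hr hres
  obtain ⟨p, hp, hpd⟩ := hz r hr fun i => by simpa only [hinner] using hres i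
  refine ⟨p.ofLp, fun i => by simpa only [hinner] using hp i, ?_⟩
  -- The maximum norm is at most the Euclidean norm, so `κ` is unchanged.
  refine (pi_norm_le_iff_of_nonneg (by positivity)).2 fun i => ?_
  exact (PiLp.norm_apply_le (WithLp.toLp 2 z.2 - p) i).trans hpd

/-- Inner semicontinuity in terms of neighbourhoods. -/
theorem InnerSemicontinuousAt.eventually_exists {Υ : Vec n → Set (Vec m)} {xb : Vec n}
    {yb : Vec m} (h : InnerSemicontinuousAt Υ xb yb) {V : Set (Vec m)} (hV : V ∈ 𝓝 yb) :
    ∀ᶠ x in 𝓝 xb, ∃ p ∈ V, p ∈ Υ x := by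
  by_contra hcon
  obtain ⟨x, hx, hnot⟩ := exists_seq_forall_of_frequently (not_eventually.1 hcon)
  obtain ⟨y, hy, hmem⟩ := h x hx
  obtain ⟨k, hk, hkV⟩ := (hmem.and (hy.eventually hV)).exists
  exact hnot k ⟨y k, hkV, hk⟩

variable {f : Vec n → Vec m → ℝ} {g : Vec n → Vec m → Fin q → ℝ}

theorem optVal_le {x : Vec n} {y : Vec m} (hy : y ∈ Gam g x) :
    optVal f g x ≤ (f x y : EReal) := iInf₂_le y hy

theorem optVal_eq_of_mem_Sol {x : Vec n} {y : Vec m} (hy : y ∈ Sol f g x) :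
    optVal f g x = (f x y : EReal) :=
  le_antisymm (optVal_le hy.1) (le_iInf₂ fun z hz => EReal.coe_le_coe_iff.2 (hy.2 z hz))

/-- Where solutions exist, they are the feasible points whose value is at most the optimal one. -/
theorem mem_Sol_of_le {x : Vec n} {y z : Vec m} (hz : z ∈ Sol f g x) (hy : y ∈ Gam g x)
    (hle : f x y ≤ (optVal f g x).toReal) : y ∈ Sol f g x := by
  rw [optVal_eq_of_mem_Sol hz, EReal.toReal_coe] at hle
  exact ⟨hy, fun w hw => hle.trans (hz.2 w hw)⟩

theorem mem_Phi_of_mem_Sol {x : Vec n} {y : Vec m} (hy : y ∈ Sol f g x) : y ∈ Phi f g x := by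
  rintro (_ | i)
  · change (f x y : EReal) - optVal f g x ≤ 0
    rw [EReal.sub_nonpos, optVal_eq_of_mem_Sol hy]
  · exact EReal.coe_nonpos.2 (hy.1 i)

/-- A linear estimate for the distance to the solution set near `(xb, yb)`. -/
def SolutionErrorBound (f : Vec n → Vec m → ℝ) (g : Vec n → Vec m → Fin q → ℝ) (xb : Vec n)
    (yb : Vec m) (κ : ℝ) : Prop :=
  ∀ᶠ z : Vec n × Vec m in 𝓝 (xb, yb),
    optVal f g z.1 = ((optVal f g z.1).toReal : EReal) ∧
    ∀ r, 0 ≤ r → f z.1 z.2 - (optVal f g z.1).toReal ≤ r → (∀ i, g z.1 z.2 i ≤ r) →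
      ∃ p ∈ Sol f g z.1, ‖z.2 - p‖ ≤ κ * r

theorem setDist_le_of_mem {y p : Vec m} {s : Set (Vec m)} {r : ℝ} (hp : p ∈ s)
    (h : ‖y - p‖ ≤ r) : setDist y s ≤ (r : EReal) := by
  have h1 : Metric.infEDist y s ≤ ENNReal.ofReal r := by
    refine (Metric.infEDist_le_edist_of_mem hp).trans ?_
    rw [edist_dist, dist_eq_norm]
    exact ENNReal.ofReal_le_ofReal h
  calc setDist y s ≤ ((ENNReal.ofReal r : ENNReal) : EReal) :=
        EReal.coe_ennreal_le_coe_ennreal_iff.2 h1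
    _ = (r : EReal) := by
        rw [EReal.coe_ennreal_ofReal, max_eq_left ((norm_nonneg _).trans h)]

/-- Solutions lie in `Phi`, so the error bound applies with `r` the maximal residual, once that is
known to be a finite number. -/
theorem SolutionErrorBound.rRegularAt {xb : Vec n} {yb : Vec m} {κ : ℝ} (hκ : 0 < κ)
    (h : SolutionErrorBound f g xb yb κ) :
    RRegularAt (valueConstraints f g) (dom (Phi f g)) xb yb := by
  obtain ⟨ε, hε, h⟩ := Metric.eventually_nhds_iff.1 h
  refine ⟨κ, hκ, ε, hε, fun x y hxy _ => ?_⟩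
  obtain ⟨hφ, hr⟩ := h hxy
  dsimp only at hφ hr
  set φ := (optVal f g x).toReal
  have hnone : valueConstraints f g none x y = ((f x y - φ : ℝ) : EReal) := by
    change (f x y : EReal) - optVal f g x = _
    rw [hφ, EReal.coe_sub]
  set s : EReal := max 0 (⨆ i, valueConstraints f g i x y) with hs
  have hs0 : 0 ≤ s := le_max_left _ _
  have hle : ∀ i, valueConstraints f g i x y ≤ s := fun i =>
    (le_iSup (fun i => valueConstraints f g i x y) i).trans (le_max_right _ _)
  have hsfin : s ≠ ⊤ := by
    refine ne_top_of_le_ne_top (EReal.coe_ne_top (|f x y - φ| + ∑ i, |g x y i|)) ?_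
    have hsum : 0 ≤ ∑ i, |g x y i| := Finset.sum_nonneg fun i _ => abs_nonneg _
    refine max_le (EReal.coe_nonneg.2 (by positivity)) (iSup_le ?_)
    rintro (_ | i)
    · rw [hnone, EReal.coe_le_coe_iff]
      linarith [le_abs_self (f x y - φ)]
    · refine EReal.coe_le_coe_iff.2 ?_
      have := Finset.single_le_sum (f := fun i => |g x y i|) (fun i _ => abs_nonneg _)
        (Finset.mem_univ i)
      linarith [le_abs_self (g x y i), abs_nonneg (f x y - φ)]
  have hsr : ((s.toReal : ℝ) : EReal) = s :=
    EReal.coe_toReal hsfin (ne_bot_of_le_ne_bot (by simp) hs0)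
  obtain ⟨p, hp, hpd⟩ := hr s.toReal (EReal.toReal_nonneg hs0)
    (by rw [← EReal.coe_le_coe_iff, hsr, ← hnone]; exact hle none)
    (fun i => by rw [← EReal.coe_le_coe_iff, hsr]; exact hle (some i))
  refine (setDist_le_of_mem (mem_Phi_of_mem_Sol hp) hpd).trans_eq ?_
  rw [EReal.coe_mul, hsr]

/-- At a feasible point `r = f - φ` is nonnegative and dominates every residual, so `α = κ⁻¹` works.
-/
theorem SolutionErrorBound.luwsmc {xb : Vec n} {yb : Vec m} {κ : ℝ} (hκ : 0 < κ)
    (h : SolutionErrorBound f g xb yb κ) : LUWSMC f g xb yb := by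
  obtain ⟨ε, hε, h⟩ := Metric.eventually_nhds_iff.1 h
  refine ⟨κ⁻¹, inv_pos.2 hκ, ε, hε, ?_⟩
  rintro ⟨x, y⟩ ⟨hy, hxy⟩
  obtain ⟨hφ, hr⟩ := h hxy
  dsimp only at hφ hr ⊢
  have hy' : y ∈ Gam g x := hy
  have h0 : 0 ≤ f x y - (optVal f g x).toReal := by
    rw [sub_nonneg, ← EReal.coe_le_coe_iff, ← hφ]
    exact optVal_le hy'
  obtain ⟨p, hp, hpd⟩ := hr _ h0 le_rfl fun i => (hy' i).trans h0
  calc ((κ⁻¹ : ℝ) : EReal) * setDist y (Sol f g x)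
      ≤ ((κ⁻¹ : ℝ) : EReal) * ((κ * (f x y - (optVal f g x).toReal) : ℝ) : EReal) :=
        mul_le_mul_of_nonneg_left (setDist_le_of_mem hp hpd)
          (EReal.coe_nonneg.2 (inv_nonneg.2 hκ.le))
    _ = ((f x y - (optVal f g x).toReal : ℝ) : EReal) := by
        rw [← EReal.coe_mul, inv_mul_cancel_left₀ hκ.ne']
    _ = (f x y : EReal) - optVal f g x := by
        rw [EReal.coe_sub, ← hφ]

/-- Exact penalization: replace `y` by a solution `p` with `‖y - p‖ ≤ κ |u|`. Local minimality
applies at `(x, p)`, and the replacement changes `F` by at most `K κ |u|`. -/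
theorem SolutionErrorBound.partiallyCalm {xb : Vec n} {yb : Vec m} {κ : ℝ} (hκ : 0 < κ)
    (h : SolutionErrorBound f g xb yb κ) {F : Vec n × Vec m → ℝ} {X : Set (Vec n)}
    (hF : LocallyLipschitz F) (hmin : IsLocalMinimizerBPP f g F X xb yb) :
    PartiallyCalm f g F X xb yb := by
  obtain ⟨-, -, γ, hγ, hmin⟩ := hmin
  obtain ⟨K, N, hN, hK⟩ := hF (xb, yb)
  obtain ⟨ρ, hρ, hρN⟩ := Metric.mem_nhds_iff.1 hN
  obtain ⟨ε, hε, h⟩ := Metric.eventually_nhds_iff.1 h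
  set η := min ε (min γ ρ)
  have hη : 0 < η := lt_min hε (lt_min hγ hρ)
  -- Chosen so that `δ + κ * δ = η / 2`, which keeps `(x, p)` as well as `(x, y)` in the ball of
  -- radius `η`.
  set δ := η / (2 * (1 + κ)) with hδ
  have hδ0 : 0 < δ := by positivity
  have hδη : δ + κ * δ < η := by
    have : δ + κ * δ = η / 2 := by rw [hδ]; field_simp
    linarith
  refine ⟨δ, hδ0, K * κ + 1, by positivity, fun x y u hxyu hx hf hg => ?_⟩
  simp only [Metric.mem_closedBall, Prod.dist_eq, max_le_iff, Real.dist_eq, sub_zero] at hxyu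
  obtain ⟨hdx, hdy, hdu⟩ := hxyu
  have hδη' : δ < η := by nlinarith
  have hxy : dist (x, y) (xb, yb) < η := by
    rw [Prod.dist_eq]
    exact max_lt (hdx.trans_lt hδη') (hdy.trans_lt hδη')
  obtain ⟨hφ, hr⟩ := h (hxy.trans_le (min_le_left _ _))
  dsimp only at hφ hr
  have hy : y ∈ Gam g x := hg
  have h0 : 0 ≤ f x y - (optVal f g x).toReal := by
    rw [sub_nonneg, ← EReal.coe_le_coe_iff, ← hφ]
    exact optVal_le hy
  have hfu : f x y - (optVal f g x).toReal ≤ |u| := by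
    rw [hφ, ← EReal.coe_sub, EReal.coe_le_coe_iff] at hf
    exact hf.trans (le_abs_self u)
  obtain ⟨p, hp, hpd⟩ := hr |u| (abs_nonneg u) hfu fun i => (hg i).trans (abs_nonneg u)
  have hxp : dist (x, p) (xb, yb) < η := by
    rw [Prod.dist_eq]
    refine max_lt (hdx.trans_lt hδη') ?_
    calc dist p yb ≤ dist p y + dist y yb := dist_triangle _ _ _
      _ ≤ κ * δ + δ := by
          refine add_le_add ?_ hdy
          rw [dist_comm, dist_eq_norm]
          exact hpd.trans (mul_le_mul_of_nonneg_left hdu hκ.le)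
      _ < η := by linarith
  have hηρ : η ≤ ρ := (min_le_right _ _).trans (min_le_right _ _)
  have hηγ : η ≤ γ := (min_le_right _ _).trans (min_le_left _ _)
  have h1 : F (xb, yb) ≤ F (x, p) := hmin x p (hxp.trans_le hηγ) hx hp
  have h2 : F (x, p) - F (x, y) ≤ K * dist (x, p) (x, y) :=
    (le_abs_self _).trans
      (hK.dist_le_mul _ (hρN (hxp.trans_le hηρ)) _ (hρN (hxy.trans_le hηρ)))
  have h3 : dist (x, p) (x, y) ≤ κ * |u| := by
    rw [Prod.dist_eq, dist_self, max_eq_right dist_nonneg, dist_comm, dist_eq_norm]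
    exact hpd
  have h4 : K * dist (x, p) (x, y) ≤ K * (κ * |u|) :=
    mul_le_mul_of_nonneg_left h3 K.coe_nonneg
  nlinarith [abs_nonneg u]

/-! ### Continuity of the optimal value -/

/-- The optimal value function is continuous at points where the feasible set mapping is lower
semicontinuous and nearby problems have uniformly bounded solutions. -/
theorem continuousAt_optVal {x₀ : Vec n} {y₀ : Vec m} {K : Set (Vec m)} (hK : IsCompact K)
    (hf : Continuous fun z : Vec n × Vec m => f z.1 z.2)
    (hg : ∀ i, Continuous fun z : Vec n × Vec m => g z.1 z.2 i)
    (hy₀ : y₀ ∈ Sol f g x₀)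
    (hΓ : ∀ V ∈ 𝓝 y₀, ∀ᶠ x in 𝓝 x₀, ∃ p ∈ V, p ∈ Gam g x)
    (hbdd : ∀ᶠ x in 𝓝 x₀, ∃ p ∈ K, p ∈ Sol f g x) :
    ContinuousAt (optVal f g) x₀ := by
  have hf' : Continuous fun z : Vec n × Vec m => (f z.1 z.2 : EReal) :=
    continuous_coe_real_ereal.comp hf
  refine tendsto_order.2 ⟨fun a ha => ?_, fun a ha => ?_⟩
  -- Near a feasible point the value stays above `a`; near an infeasible one infeasibility persists.
  -- Compactness of `K` makes this uniform in `y`.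
  · have hloc : ∀ y ∈ K, ∀ᶠ z : Vec n × Vec m in 𝓝 (x₀, y),
        z.2 ∈ Gam g z.1 → a < (f z.1 z.2 : EReal) := by
      intro y _
      by_cases hy : y ∈ Gam g x₀
      · have : a < (f x₀ y : EReal) := ha.trans_le (optVal_le hy)
        filter_upwards [hf'.continuousAt.eventually_const_lt this] with z hz _ using hz
      · simp only [Gam, mem_ofPred_eq, not_forall, not_le] at hy
        obtain ⟨i, hi⟩ := hy
        filter_upwards [(hg i).continuousAt.eventually_const_lt hi] with z hz hzΓ
        exact absurd (hzΓ i) (not_le.2 hz)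
    have := hK.eventually_forall_of_forall_eventually
      (P := fun x y => y ∈ Gam g x → a < (f x y : EReal)) hloc
    filter_upwards [this, hbdd] with x hx ⟨p, hpK, hp⟩
    rw [optVal_eq_of_mem_Sol hp]
    exact hx p hpK hp.1
  · rw [optVal_eq_of_mem_Sol hy₀] at ha
    have hlt : ∀ᶠ z : Vec n × Vec m in 𝓝 (x₀, y₀), (f z.1 z.2 : EReal) < a :=
      (hf'.tendsto (x₀, y₀)).eventually_lt_const ha
    rw [nhds_prod_eq] at hlt
    obtain ⟨pa, hpa, pb, hpb, hab⟩ := eventually_prod_iff.1 hlt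
    filter_upwards [hpa, hΓ _ hpb] with x hx ⟨p, hp, hpΓ⟩
    exact (optVal_le hpΓ).trans_lt (hab hx hp)

end ErrorBound

/-! ### Constant rank and the linear lower level problem -/

section LinearLowerLevel

variable {n m q : ℕ}

theorem linearIndepOn_comp_iff_image {R N α β : Type*} [Semiring R] [AddCommMonoid N] [Module R N]
    {e : α → β} (he : Function.Injective e) (v : β → N) (s : Set α) :
    LinearIndepOn R (v ∘ e) s ↔ LinearIndepOn R v (e '' s) :=
  ⟨fun h => h.image_of_comp e v, fun h => h.comp_of_image he.injOn⟩

theorem linearIndependent_row_iff_rank {κ : Type*} [Fintype κ] (A : Matrix κ (Fin m) ℝ) :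
    LinearIndependent ℝ A.row ↔ A.rank = Fintype.card κ := by
  rw [linearIndependent_iff_card_eq_finrank_span, Matrix.rank_eq_finrank_span_row, eq_comm,
    Set.finrank]

/-- The rows of the lower level data: the objective and then all constraints. -/
def lowerRows (c : Vec n → Vec m) (B : Vec n → Matrix (Fin q) (Fin m) ℝ) (x : Vec n) :
    Option (Fin q) → Vec m
  | none => c x
  | some i => B x i

/-- Rows are independent exactly when the rank of their submatrix equals their number, so constant
rank carries independence from `x` to `xb`. -/
theorem ConstantRankNear.linearIndepOn {c : Vec n → Vec m}
    {B : Vec n → Matrix (Fin q) (Fin m) ℝ} {I : Set (Fin q)} {xb : Vec n}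
    (h : ConstantRankNear c B I xb) :
    ∀ᶠ x in 𝓝 xb, ∀ t : Set (Option (Fin q)), t ⊆ {o | ∀ i, o = some i → i ∈ I} →
      LinearIndepOn ℝ (lowerRows c B x) t → LinearIndepOn ℝ (lowerRows c B xb) t := by
  classical
  obtain ⟨U, hU, hrank⟩ := h
  let e : Unit ⊕ I → Option (Fin q) := Sum.elim (fun _ => none) (fun i => some i)
  have he : Function.Injective e := by
    rintro (_ | ⟨i, hi⟩) (_ | ⟨j, hj⟩) h <;> simp_all [e]
  have hrows : ∀ x, lowerRows c B x ∘ e = (augMatrix c B I x).row := by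
    intro x
    funext o
    rcases o with _ | i <;> rfl
  filter_upwards [hU] with x hx t ht hli
  have himage : e '' (e ⁻¹' t) = t := by
    refine image_preimage_eq_of_subset ?_
    rintro (_ | i) ho
    · exact ⟨Sum.inl (), rfl⟩
    · exact ⟨Sum.inr ⟨i, ht ho i rfl⟩, rfl⟩
  rw [← himage, ← linearIndepOn_comp_iff_image he, hrows] at hli ⊢
  have := Fintype.ofFinite (e ⁻¹' t)
  have key : ∀ z, LinearIndepOn ℝ (augMatrix c B I z).row (e ⁻¹' t) ↔
      ((augMatrix c B I z).submatrix (fun j : (e ⁻¹' t : Set _) => (j : Unit ⊕ I)) id).rank =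
        Fintype.card (e ⁻¹' t : Set _) := fun z => by
    rw [← linearIndependent_row_iff_rank]
    rfl
  rw [key] at hli ⊢
  rw [← hli]
  exact hrank _ _ (mem_of_mem_nhds hU) _ hx

/-- The uniform Hoffman bound for `S(x)`. The objective row always counts as relevant, so `φ` may
enter the right-hand side without any continuity. -/
theorem exists_solutionErrorBound (c : Vec n → Vec m) (A : Vec n → Vec q)
    (B : Vec n → Matrix (Fin q) (Fin m) ℝ) (hc : Continuous c) (hA : Continuous A)
    (hB : Continuous B) (xb : Vec n) (yb : Vec m)
    (hyb : yb ∈ Sol (linObj c) (linCon A B) xb)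
    (hS : InnerSemicontinuousAt (Sol (linObj c) (linCon A B)) xb yb)
    (hrank : ConstantRankNear c B (activeSet A B xb yb) xb) :
    ∃ κ : ℝ, 0 < κ ∧ SolutionErrorBound (linObj c) (linCon A B) xb yb κ := by
  have hcon : ∀ x y i, linCon A B x y i = A x i + B x i ⬝ᵥ y := fun x y i => rfl
  have hrows : ∀ o, Continuous fun x => lowerRows c B x o := by
    rintro (_ | i)
    · exact hc
    · exact (continuous_apply i).comp hB
  -- `toReal` is harmless where solutions exist, hence for all `x` near `xb`.
  let d : Vec n → Option (Fin q) → ℝ := fun x o =>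
    o.elim (optVal (linObj c) (linCon A B) x).toReal fun i => - A x i
  have hsol : ∀ᶠ x in 𝓝 xb, ∃ p ∈ univ, p ∈ Sol (linObj c) (linCon A B) x :=
    hS.eventually_exists univ_mem
  have hd : ∀ x y, y ∈ Sol (linObj c) (linCon A B) x → ∀ o, lowerRows c B x o ⬝ᵥ y ≤ d x o := by
    rintro x y hy (_ | i)
    · change linObj c x y ≤ (optVal (linObj c) (linCon A B) x).toReal
      rw [optVal_eq_of_mem_Sol hy, EReal.toReal_coe]
    · have := hy.1 i
      rw [hcon] at this
      change B x i ⬝ᵥ y ≤ - A x i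
      linarith
  have hI : ∀ o ∉ {o | ∀ i, o = some i → i ∈ activeSet A B xb yb},
      ∀ᶠ z : Vec n × Vec m in 𝓝 (xb, yb), lowerRows c B z.1 o ⬝ᵥ z.2 < d z.1 o := by
    intro o ho
    simp only [mem_ofPred_eq, not_forall] at ho
    obtain ⟨i, rfl, hi⟩ := ho
    have hlt : B xb i ⬝ᵥ yb + A xb i < 0 := by
      have := lt_of_le_of_ne (hyb.1 i) hi
      rw [hcon] at this
      linarith
    have hcont : Continuous fun z : Vec n × Vec m => B z.1 i ⬝ᵥ z.2 + A z.1 i := by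
      exact (((hrows (some i)).comp continuous_fst).dotProduct continuous_snd).add
        ((continuous_apply i).comp (hA.comp continuous_fst))
    filter_upwards [(hcont.tendsto (xb, yb)).eventually_lt_const hlt] with z hz
    change B z.1 i ⬝ᵥ z.2 < - A z.1 i
    linarith
  have hisc : ∀ V ∈ 𝓝 yb, ∀ᶠ x in 𝓝 xb, ∃ p ∈ V, ∀ o, lowerRows c B x o ⬝ᵥ p ≤ d x o := by
    intro V hV
    filter_upwards [hS.eventually_exists hV] with x ⟨p, hpV, hp⟩
    exact ⟨p, hpV, hd x p hp⟩
  obtain ⟨κ, hκ, h⟩ := exists_uniform_hoffman_vec (lowerRows c B) d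
    {o | ∀ i, o = some i → i ∈ activeSet A B xb yb} xb yb (fun o => (hrows o).continuousAt) hI
    (hrank.linearIndepOn.mono fun x hx t => hx t) hisc
  refine ⟨κ, hκ, ?_⟩
  have hsol' := (continuous_fst.tendsto (xb, yb)).eventually hsol
  filter_upwards [h, hsol'] with z hz ⟨w, _, hw⟩
  refine ⟨by rw [optVal_eq_of_mem_Sol hw, EReal.toReal_coe], fun r hr hf hg => ?_⟩
  obtain ⟨p, hp, hpd⟩ := hz r hr (by
    rintro (_ | i)
    · exact hf
    · have := hg i
      rw [hcon] at this
      change B z.1 i ⬝ᵥ z.2 - - A z.1 i ≤ r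
      linarith)
  refine ⟨p, mem_Sol_of_le hw (fun i => ?_) (hp none), hpd⟩
  have : B z.1 i ⬝ᵥ p ≤ - A z.1 i := hp (some i)
  rw [hcon]
  linarith

/-- Inner semicontinuity of `S` is given at `xb` only. The Hoffman bound for the constraints alone
extends lower semicontinuity of `Γ` to all nearby points of its graph. -/
theorem exists_nhds_continuousOn_optVal (c : Vec n → Vec m) (A : Vec n → Vec q)
    (B : Vec n → Matrix (Fin q) (Fin m) ℝ) (hc : Continuous c) (hA : Continuous A)
    (hB : Continuous B) (xb : Vec n) (yb : Vec m)
    (hyb : yb ∈ Sol (linObj c) (linCon A B) xb)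
    (hS : InnerSemicontinuousAt (Sol (linObj c) (linCon A B)) xb yb)
    (hrank : ConstantRankNear c B (activeSet A B xb yb) xb) :
    ∃ V ∈ 𝓝 xb, ContinuousOn (optVal (linObj c) (linCon A B)) V ∧
      ∀ x ∈ V, optVal (linObj c) (linCon A B) x ≠ ⊥ ∧ optVal (linObj c) (linCon A B) x ≠ ⊤ := by
  have hcon : ∀ x y i, linCon A B x y i = A x i + B x i ⬝ᵥ y := fun x y i => rfl
  have hrow : ∀ i, Continuous fun x => B x i := fun i => (continuous_apply i).comp hB
  have hf : Continuous fun z : Vec n × Vec m => linObj c z.1 z.2 :=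
    (hc.comp continuous_fst).dotProduct continuous_snd
  have hg : ∀ i, Continuous fun z : Vec n × Vec m => linCon A B z.1 z.2 i := fun i =>
    ((continuous_apply i).comp (hA.comp continuous_fst)).add
      (((hrow i).comp continuous_fst).dotProduct continuous_snd)
  have hrank' : ∀ᶠ x in 𝓝 xb, ∀ t : Finset (Fin q), (t : Set (Fin q)) ⊆ activeSet A B xb yb →
      LinearIndepOn ℝ (B x) (t : Set (Fin q)) → LinearIndepOn ℝ (B xb) (t : Set (Fin q)) := by
    filter_upwards [hrank.linearIndepOn] with x hx t ht hli
    have hsome : Function.Injective (some : Fin q → Option (Fin q)) := Option.some_injective _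
    refine (linearIndepOn_comp_iff_image hsome (lowerRows c B xb) t).2
      (hx _ ?_ ((linearIndepOn_comp_iff_image hsome (lowerRows c B x) t).1 hli))
    rintro _ ⟨i, hi, rfl⟩ j hj
    exact Option.some_injective _ hj ▸ ht hi
  have hI : ∀ i ∉ activeSet A B xb yb,
      ∀ᶠ z : Vec n × Vec m in 𝓝 (xb, yb), B z.1 i ⬝ᵥ z.2 < - A z.1 i := by
    intro i hi
    have hlt : linCon A B xb yb i < 0 := lt_of_le_of_ne (hyb.1 i) hi
    filter_upwards [((hg i).tendsto (xb, yb)).eventually_lt_const hlt] with z hz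
    rw [hcon] at hz
    linarith
  have hisc : ∀ V ∈ 𝓝 yb, ∀ᶠ x in 𝓝 xb, ∃ p ∈ V, ∀ i, B x i ⬝ᵥ p ≤ - A x i := by
    intro V hV
    filter_upwards [hS.eventually_exists hV] with x ⟨p, hpV, hp⟩
    refine ⟨p, hpV, fun i => ?_⟩
    have := hp.1 i
    rw [hcon] at this
    linarith
  obtain ⟨κ, hκ, h⟩ := exists_uniform_hoffman_vec B (fun x i => - A x i)
    (activeSet A B xb yb) xb yb (fun i => (hrow i).continuousAt) hI hrank' hisc
  have hΓ : ∀ᶠ z : Vec n × Vec m in 𝓝 (xb, yb), z.2 ∈ Gam (linCon A B) z.1 →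
      ∀ V ∈ 𝓝 z.2, ∀ᶠ x in 𝓝 z.1, ∃ p ∈ V, p ∈ Gam (linCon A B) x := by
    filter_upwards [h.eventually_nhds]
    rintro ⟨x₀, y₀⟩ hz hy₀ V hV
    obtain ⟨ε, hε, hεV⟩ := Metric.mem_nhds_iff.1 hV
    have hpair : Tendsto (fun x => (x, y₀)) (𝓝 x₀) (𝓝 (x₀, y₀)) :=
      (continuous_id.prodMk continuous_const).tendsto x₀
    -- The constraint violation of the fixed point `y₀` becomes arbitrarily small as `x → x₀`; below
    -- `ε / (2 * κ)` it yields a feasible point within `ε / 2` of `y₀`.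
    have hres : ∀ᶠ x in 𝓝 x₀, ∀ i, linCon A B x y₀ i < ε / (2 * κ) := by
      rw [eventually_all]
      intro i
      exact (((hg i).tendsto (x₀, y₀)).comp hpair).eventually_lt_const
        ((hy₀ i).trans_lt (by positivity))
    filter_upwards [hpair.eventually hz, hres] with x hx hxr
    obtain ⟨p, hp, hpd⟩ := hx (ε / (2 * κ)) (by positivity) fun i => by
      have := hxr i
      rw [hcon] at this
      linarith
    refine ⟨p, hεV ?_, fun i => ?_⟩
    · rw [Metric.mem_ball, dist_comm, dist_eq_norm]
      have : κ * (ε / (2 * κ)) = ε / 2 := by field_simp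
      linarith
    · have := hp i
      rw [hcon]
      linarith
  rw [nhds_prod_eq] at hΓ
  obtain ⟨pa, hpa, pb, hpb, hab⟩ := eventually_prod_iff.1 hΓ
  have hbdd : ∀ᶠ x in 𝓝 xb, ∃ p ∈ Metric.closedBall yb 1, p ∈ Sol (linObj c) (linCon A B) x :=
    hS.eventually_exists (Metric.closedBall_mem_nhds yb one_pos)
  -- The neighbourhood consists of points having a solution close to `yb` and around which solutions
  -- exist in the unit ball about `yb`.
  refine ⟨_, hpa.and ((hS.eventually_exists hpb).and hbdd.eventually_nhds), ?_, ?_⟩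
  · rintro x ⟨hx, ⟨y, hy, hyS⟩, hb⟩
    exact (continuousAt_optVal (isCompact_closedBall yb 1) hf hg hyS
      (hab hx hy hyS.1) hb).continuousWithinAt
  · rintro x ⟨-, ⟨y, -, hyS⟩, -⟩
    rw [optVal_eq_of_mem_Sol hyS]
    exact ⟨EReal.coe_ne_bot _, EReal.coe_ne_top _⟩

end LinearLowerLevel

end Bilevel

theorem mainTheorem3 {n m q : ℕ}
    (c : Bilevel.Vec n → Bilevel.Vec m) (A : Bilevel.Vec n → Bilevel.Vec q)
    (B : Bilevel.Vec n → Matrix (Fin q) (Fin m) ℝ)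
    (hc : LocallyLipschitz c) (hA : LocallyLipschitz A)
    (hB : ∀ i j, LocallyLipschitz (fun x => B x i j))
    (xb : Bilevel.Vec n) (yb : Bilevel.Vec m)
    (hyb : yb ∈ Bilevel.Sol (Bilevel.linObj c) (Bilevel.linCon A B) xb)
    (hS : Bilevel.InnerSemicontinuousAt
      (Bilevel.Sol (Bilevel.linObj c) (Bilevel.linCon A B)) xb yb)
    (hrank : Bilevel.ConstantRankNear c B (Bilevel.activeSet A B xb yb) xb) :
    Bilevel.RRCQ (Bilevel.linObj c) (Bilevel.linCon A B) xb yb ∧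
    Bilevel.LUWSMC (Bilevel.linObj c) (Bilevel.linCon A B) xb yb ∧
    ∀ (F : Bilevel.Vec n × Bilevel.Vec m → ℝ) (X : Set (Bilevel.Vec n)),
      LocallyLipschitz F → X.Nonempty → IsClosed X →
      Bilevel.IsLocalMinimizerBPP (Bilevel.linObj c) (Bilevel.linCon A B) F X xb yb →
      Bilevel.PartiallyCalm (Bilevel.linObj c) (Bilevel.linCon A B) F X xb yb := by
  have hBc : Continuous B :=
    continuous_pi fun i => continuous_pi fun j => (hB i j).continuous
  obtain ⟨κ, hκ, h⟩ := Bilevel.exists_solutionErrorBound c A B hc.continuous hA.continuous hBc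
    xb yb hyb hS hrank
  exact ⟨⟨Bilevel.exists_nhds_continuousOn_optVal c A B hc.continuous hA.continuous hBc
    xb yb hyb hS hrank, h.rRegularAt hκ⟩, h.luwsmc hκ,
    fun F X hF _ _ hmin => h.partiallyCalm hκ hF hmin⟩
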